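/- Let $\alpha=(\alpha_1,\dots,\alpha_t)$ be positive integers with $t\ge 2$ and $\alpha_1,\alpha_t\ge 2$, and put $n=\alpha_1+\cdots+\alpha_t-1$ and $A_i=\alpha_1+\cdots+\alpha_i$ for $0\le i\le t$. Let $F=\breve F(\alpha)$ be the fence on $\{x_1,\dots,x_n\}$ whose $i$-th segment is $S_i=\{x_k : 1\le k\le n,\ A_{i-1}\le k\le A_i\}$; two elements are comparable if and only if they lie in a common segment, and the order along $S_i$ is increasing from left to right for $i$ odd and decreasing for $i$ even: $$x_1\vartriangleleft\cdots\vartriangleleft x_{\alpha_1}\vartriangleright\cdots\vartriangleright x_{\alpha_1+\alpha_2}\vartriangleleft\cdots .$$ The shared elements $x_{A_1},\dots,x_{A_{t-1}}$ belong to two segments each and are alternately peaks (covering two elements: $x_{A_i}$ with $i$ odd) and valleys (covered by two elements: $x_{A_i}$ with $i$ even). The other elements are unshared; $S_i$ has $\beta_i=\alpha_i-1$ unshared elements, and $s_{(i,j)}$ denotes the $j$-th smallest of them. For an order ideal (down-set) $I$ of $F$ and $x\in F$ let $\hat\chi_x(I)=1$ if $x\in I$ and $\hat\chi_x(I)=0$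 otherwise, and write $\hat\chi_{(i,j)}=\hat\chi_{s_{(i,j)}}$. The toggle $\tau_k$ maps $I$ to $I\cup\{x_k\}$ if $x_k$ is minimal in $F\setminus I$, to $I\setminus\{x_k\}$ if $x_k$ is maximal in $I$, and to $I$ otherwise. Promotion is the bijection $\tau_n\circ\cdots\circ\tau_1$ of the set $\mathcal J(F)$ of order ideals of $F$ (so $x_1$ is toggled first). A statistic $f:\mathcal J(F)\to\mathbb R$ is homomesic under promotion if there is a constant $c\in\mathbb R$ such that the average of $f$ over every orbit of promotion is $c$. Theorem. Every statistic in $$\operatorname{Span}_{\mathbb R}\left(\bigcup_{i=1}^t\bigcup_{j=1}^{\beta_i}\left\{\alpha_i\hat\chi_{(i,j)}-j\,\hat\chi_p-(\alpha_i-j)\,\hat\chi_v \;\middle|\; p \text{ the peak of } S_i,\ v \text{ the valley of } S_i\right\}\right)$$ is homomesic under promotion, where $\hat\chi_p$ (respectively $\hat\chi_v$) is read as $0$ if $S_i$ has no peak (respectively no valley). -/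

import Mathlib

noncomputable section

namespace FencePromotion

/-! ### Homomesy -/

/-- The orbit of `x` under the invertible operator `T`. -/
def orbit {X : Type*} [Fintype X] (T : Equiv.Perm X) (x : X) : Finset X :=
  open Classical in Finset.univ.filter fun y => T.SameCycle x y

/-- `f` is homomesic under `T`: its average over every orbit of `T` is the same constant. -/
def Homomesic {X : Type*} [Fintype X] (T : Equiv.Perm X) (f : X → ℝ) : Prop :=
  ∃ c : ℝ, ∀ x : X, (∑ y ∈ orbit T x, f y) / ((orbit T x).card : ℝ) = c

/-! ### Order ideals and toggles of a finite poset -/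

section Poset

variable {P : Type*} [PartialOrder P]

/-- The order ideals of a finite poset (Mathlib's lower sets) are finite in number. -/
instance [Finite P] : Fintype (LowerSet P) :=
  @Fintype.ofFinite _ (Finite.of_injective (fun I : LowerSet P => (I : Set P))
    SetLike.coe_injective)

/-- The order ideal indicator function of `p`. -/
def idealIndicator (p : P) (I : LowerSet P) : ℝ :=
  open Classical in if p ∈ I then 1 else 0

/-- `I ∪ {p}`, for `p` a minimal element of the complement of `I`. -/
def addMin (p : P) (I : LowerSet P) (h : Minimal (fun x => x ∉ I) p) : LowerSet P where
  carrier := (I : Set P) ∪ {p}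
  lower' := by
    rintro a b hba (ha | ha)
    · exact Or.inl (I.lower hba ha)
    · have ha' : a = p := ha
      subst ha'
      by_cases hb : b ∈ I
      · exact Or.inl hb
      · exact Or.inr (le_antisymm hba (h.2 hb hba))

/-- `I \ {p}`, for `p` a maximal element of `I`. -/
def removeMax (p : P) (I : LowerSet P) (h : Maximal (fun x => x ∈ I) p) : LowerSet P where
  carrier := (I : Set P) \ {p}
  lower' := by
    rintro a b hba ⟨ha, hap⟩
    refine ⟨I.lower hba ha, ?_⟩
    intro hb
    have hb' : b = p := hb
    subst hb'
    exact hap (le_antisymm (h.2 ha hba) hba)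

/-- The toggle at `p` as a map on order ideals. -/
def toggleFun (p : P) (I : LowerSet P) : LowerSet P :=
  open Classical in
  if h : Minimal (fun x => x ∉ I) p then addMin p I h
  else if h : Maximal (fun x => x ∈ I) p then removeMax p I h
  else I

theorem mem_addMin {p : P} {I : LowerSet P} {h : Minimal (fun x => x ∉ I) p} {x : P} :
    x ∈ addMin p I h ↔ x ∈ I ∨ x = p := Iff.rfl

theorem mem_removeMax {p : P} {I : LowerSet P} {h : Maximal (fun x => x ∈ I) p} {x : P} :
    x ∈ removeMax p I h ↔ x ∈ I ∧ x ≠ p := Iff.rfl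

theorem toggleFun_involutive (p : P) : Function.Involutive (toggleFun p) := by
  classical
  intro I
  by_cases h : Minimal (fun x => x ∉ I) p
  · have e : toggleFun p I = addMin p I h := by simp only [toggleFun, dif_pos h]
    have h1 : ¬ Minimal (fun x => x ∉ addMin p I h) p := fun h' =>
      h'.1 (mem_addMin.2 (Or.inr rfl))
    have h2 : Maximal (fun x => x ∈ addMin p I h) p := by
      refine ⟨mem_addMin.2 (Or.inr rfl), fun q hq hpq => ?_⟩
      rcases mem_addMin.1 hq with hq | hq
      · exact absurd (I.lower hpq hq) h.1
      · exact hq.le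
    rw [e]
    simp only [toggleFun, dif_neg h1, dif_pos h2]
    ext x
    change x ∈ removeMax p _ h2 ↔ x ∈ I
    rw [mem_removeMax, mem_addMin]
    constructor
    · rintro ⟨hx | hx, hxp⟩
      · exact hx
      · exact absurd hx hxp
    · intro hx
      exact ⟨Or.inl hx, fun hxp => h.1 (hxp ▸ hx)⟩
  · by_cases h' : Maximal (fun x => x ∈ I) p
    · have e : toggleFun p I = removeMax p I h' := by
        simp only [toggleFun, dif_neg h, dif_pos h']
      have h1 : Minimal (fun x => x ∉ removeMax p I h') p := by
        refine ⟨fun hp => (mem_removeMax.1 hp).2 rfl, fun q hq hqp => ?_⟩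
        by_contra hpq
        exact hq (mem_removeMax.2 ⟨I.lower hqp h'.1, fun hqp' => hpq hqp'.ge⟩)
      rw [e]
      simp only [toggleFun, dif_pos h1]
      ext x
      change x ∈ addMin p _ h1 ↔ x ∈ I
      rw [mem_addMin, mem_removeMax]
      constructor
      · rintro (hx | hx)
        · exact hx.1
        · exact hx ▸ h'.1
      · intro hx
        by_cases hxp : x = p
        · exact Or.inr hxp
        · exact Or.inl ⟨hx, hxp⟩
    · simp only [toggleFun, dif_neg h, dif_neg h']

/-- The toggle `τ_p`, an invertible operator (an involution) on order ideals. -/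
def toggle (p : P) : Equiv.Perm (LowerSet P) :=
  (toggleFun_involutive p).toPerm

end Poset

/-! ### Fences -/

/-- The shape `α = (α₁, …, α_t)` of a fence: positive integers with `t ≥ 2` and
`α₁, α_t ≥ 2`. Segments are indexed by `Fin t`, so the `i`-th segment has index `i - 1`. -/
structure Shape where
  t : ℕ
  two_le : 2 ≤ t
  α : Fin t → ℕ
  pos : ∀ i, 0 < α i
  first : ∀ i : Fin t, i.val = 0 → 2 ≤ α i
  last : ∀ i : Fin t, i.val + 1 = t → 2 ≤ α i

namespace Shape

variable (F : Shape)

/-- The partial sum `α₁ + ⋯ + α_k`. For `1 ≤ k ≤ t - 1` this is the position of the shared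
element `s_k`; the values for `k = 0` and `k = t` are one place before the first and
one place after the last element of the fence. -/
def bd (k : ℕ) : ℕ := ∑ i : Fin F.t with i.val < k, F.α i

/-- The number of elements of the fence, `α₁ + ⋯ + α_t - 1`. -/
def size : ℕ := F.bd F.t - 1

/-- The underlying set `{x₁, …, x_n}` of the fence, `n = α₁ + ⋯ + α_t - 1`: the element `x_k`
is the number `k` with `0 < k < α₁ + ⋯ + α_t`. -/
def Elem : Type := {k : ℕ // 0 < k ∧ k < F.bd F.t}

variable {F}

/-- `x` belongs to the segment with index `i`. -/
def InSegment (i : Fin F.t) (x : F.Elem) : Prop :=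
  F.bd i.val ≤ x.val ∧ x.val ≤ F.bd (i.val + 1)

/-- The order of the fence. Two elements are comparable if and only if they lie in a common
segment; along the first, third, … segments (even index) the order increases from left to
right, along the second, fourth, … it decreases. -/
def Le (x y : F.Elem) : Prop :=
  ∃ i : Fin F.t, InSegment i x ∧ InSegment i y ∧
    if Even i.val then x.val ≤ y.val else y.val ≤ x.val

theorem bd_succ (i : Fin F.t) : F.bd (i.val + 1) = F.bd i.val + F.α i := by
  have h : (Finset.univ.filter fun j : Fin F.t => j.val < i.val + 1)
      = insert i (Finset.univ.filter fun j : Fin F.t => j.val < i.val) := by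
    ext j
    simp only [Finset.mem_filter, Finset.mem_univ, true_and, Finset.mem_insert, Fin.ext_iff]
    omega
  rw [bd, h, Finset.sum_insert (by simp), bd, add_comm]

theorem bd_mono : Monotone F.bd := fun a b hab =>
  Finset.sum_le_sum_of_subset fun j hj => by
    simp only [Finset.mem_filter, Finset.mem_univ, true_and] at hj ⊢
    omega

theorem exists_segment (x : F.Elem) : ∃ i : Fin F.t, InSegment i x := by
  have key : ∀ k : ℕ, k ≤ F.t → x.val < F.bd k → ∃ i : Fin F.t, InSegment i x := by
    intro k
    induction k with
    | zero =>
      intro _ h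
      simp [bd] at h
    | succ k ih =>
      intro hk h
      by_cases h' : x.val < F.bd k
      · exact ih (by omega) h'
      · exact ⟨⟨k, hk⟩, not_lt.1 h', h.le⟩
  exact key F.t le_rfl x.2.2

/-- Two different segments meet at most in a shared element, and then they are adjacent. -/
theorem meet {i j : Fin F.t} (hij : i.val < j.val) {y : F.Elem}
    (hi : InSegment i y) (hj : InSegment j y) :
    j.val = i.val + 1 ∧ y.val = F.bd (i.val + 1) := by
  have h1 : F.bd (i.val + 1) ≤ F.bd j.val := bd_mono hij
  have hy : y.val = F.bd (i.val + 1) := le_antisymm hi.2 (h1.trans hj.1)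
  refine ⟨?_, hy⟩
  by_contra hne
  have h2 : F.bd (i.val + 1 + 1) ≤ F.bd j.val := bd_mono (by omega)
  have h3 := bd_succ (F := F) ⟨i.val + 1, by omega⟩
  have h4 := F.pos ⟨i.val + 1, by omega⟩
  have h5 := hj.1
  simp only at h3
  omega

theorem le_refl' (x : F.Elem) : Le x x := by
  obtain ⟨i, hi⟩ := exists_segment x
  exact ⟨i, hi, hi, by split_ifs <;> exact le_rfl⟩

theorem le_trans' {x y z : F.Elem} (hxy : Le x y) (hyz : Le y z) : Le x z := by
  obtain ⟨i, hxi, hyi, h1⟩ := hxy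
  obtain ⟨j, hyj, hzj, h2⟩ := hyz
  rcases lt_trichotomy i.val j.val with hij | hij | hij
  · obtain ⟨hj, hy⟩ := meet hij hyi hyj
    by_cases hi : Even i.val
    · have hj' : ¬ Even j.val := by rw [hj]; simpa [Nat.even_add_one] using hi
      rw [if_neg hj'] at h2
      have hz : z = y := Subtype.ext (le_antisymm h2 (by rw [hy, ← hj]; exact hzj.1))
      rw [hz]
      exact ⟨i, hxi, hyi, h1⟩
    · rw [if_neg hi] at h1
      have hx : x = y := Subtype.ext (le_antisymm (by rw [hy]; exact hxi.2) h1)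
      rw [hx]
      exact ⟨j, hyj, hzj, h2⟩
  · obtain rfl : i = j := Fin.ext hij
    refine ⟨i, hxi, hzj, ?_⟩
    split_ifs with hi
    · rw [if_pos hi] at h1 h2
      exact h1.trans h2
    · rw [if_neg hi] at h1 h2
      exact h2.trans h1
  · obtain ⟨hi', hy⟩ := meet hij hyj hyi
    by_cases hj : Even j.val
    · rw [if_pos hj] at h2
      have hz : z = y := Subtype.ext (le_antisymm (by rw [hy]; exact hzj.2) h2)
      rw [hz]
      exact ⟨i, hxi, hyi, h1⟩
    · have hi : Even i.val := by rw [hi']; simpa [Nat.even_add_one] using hj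
      rw [if_pos hi] at h1
      have hx : x = y := Subtype.ext (le_antisymm h1 (by rw [hy, ← hi']; exact hxi.1))
      rw [hx]
      exact ⟨j, hyj, hzj, h2⟩

theorem le_antisymm' {x y : F.Elem} (hxy : Le x y) (hyx : Le y x) : x = y := by
  obtain ⟨i, hxi, hyi, h1⟩ := hxy
  obtain ⟨j, hyj, hxj, h2⟩ := hyx
  rcases lt_trichotomy i.val j.val with hij | hij | hij
  · exact Subtype.ext ((meet hij hxi hxj).2.trans (meet hij hyi hyj).2.symm)
  · obtain rfl : i = j := Fin.ext hij
    split_ifs at h1 h2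
    · exact Subtype.ext (le_antisymm h1 h2)
    · exact Subtype.ext (le_antisymm h2 h1)
  · exact Subtype.ext ((meet hij hxj hxi).2.trans (meet hij hyj hyi).2.symm)

/-- The fence `F̆(α)` as a poset. -/
instance : PartialOrder F.Elem where
  le := Le
  le_refl := le_refl'
  le_trans _ _ _ := le_trans'
  le_antisymm _ _ := le_antisymm'

instance : Finite F.Elem :=
  Finite.of_injective (fun x : F.Elem => (⟨x.val, x.2.2⟩ : Fin (F.bd F.t)))
    fun _ _ h => Subtype.ext (congrArg Fin.val h)

variable (F)

/-- The element `x_{k+1}` of the fence, `0 ≤ k < n`. -/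
def elem (k : Fin F.size) : F.Elem :=
  ⟨k.val + 1, Nat.succ_pos _, by have h := k.isLt; unfold size at h; omega⟩

/-- Promotion `τ_n ∘ ⋯ ∘ τ_1`: toggle the elements from left to right, `x₁` first. (The product of
permutations is composition, hence the reversal of the list `τ_1, …, τ_n`.) -/
def promotion : Equiv.Perm (LowerSet F.Elem) :=
  (List.ofFn fun k : Fin F.size => toggle (F.elem k)).reverse.prod

/-- The order ideal indicator function of the element at position `k`, and the zero function
if the fence has no element at position `k` (that is, if `k = 0` or `k > n`). -/
def indicatorAt (k : ℕ) : LowerSet F.Elem → ℝ :=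
  if h : 0 < k ∧ k < F.bd F.t then idealIndicator (⟨k, h⟩ : F.Elem) else 0

variable {F}

/-- Position of the peak of a segment: the right end of an increasing segment, the left end of
a decreasing one. It is one place outside of the fence if the segment has no peak. -/
def peakPos (i : Fin F.t) : ℕ := if Even i.val then F.bd (i.val + 1) else F.bd i.val

/-- Position of the valley of a segment: the left end of an increasing segment, the right end of
a decreasing one. It is one place outside of the fence if the segment has no valley. -/
def valleyPos (i : Fin F.t) : ℕ := if Even i.val then F.bd i.val else F.bd (i.val + 1)

/-- Position of the `j`-th smallest unshared element of a segment, `1 ≤ j ≤ α_i - 1`. The unshared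
elements occupy the positions strictly between the two ends of the segment. -/
def unsharedPos (i : Fin F.t) (j : ℕ) : ℕ :=
  if Even i.val then F.bd i.val + j else F.bd (i.val + 1) - j

/-- The statistic `α_i χ̂_(i,j) - j χ̂_p - (α_i - j) χ̂_v`, where `p` and `v` are the peak and
the valley of the segment. -/
def basisStat (i : Fin F.t) (j : ℕ) : LowerSet F.Elem → ℝ := fun I =>
  (F.α i : ℝ) * F.indicatorAt (unsharedPos i j) I
    - (j : ℝ) * F.indicatorAt (peakPos i) I
    - ((F.α i : ℝ) - (j : ℝ)) * F.indicatorAt (valleyPos i) I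

variable (F)

/-- The set of statistics `B_I(F)`: all `basisStat i j` with `1 ≤ j ≤ α_i - 1`. -/
def basisI : Set (LowerSet F.Elem → ℝ) :=
  {f | ∃ (i : Fin F.t) (j : ℕ), 1 ≤ j ∧ j ≤ F.α i - 1 ∧ f = basisStat i j}

end Shape

end FencePromotion

end

/-!
Fix an orbit of promotion and write `χ_k(I) ∈ {0, 1}` for the indicator of the `k`-th element of the
fence. Let `x_k` be an unshared element, with lower neighbour `d` and upper neighbour `u` in its
segment, and let `J` be the ideal just before `x_k` is toggled. Then `χ_u(J) ≤ χ_k(J) ≤ χ_d(J)`, the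
element `x_k` enters exactly if `χ_d(J) = 1` and stays exactly if `χ_u(J) = 1`. For values in `{0, 1}` this is the
*linear* rule `χ_k(τ_k J) + χ_k(J) = χ_d(J) + χ_u(J)` (`extIndicator_toggle`). It remains true at the
two ends of the fence if a missing valley is counted as always present and a missing peak as
always absent.

Since promotion `∂` toggles from left to right, the left neighbour of `x_k` has been updated when
`x_k` is toggled and the right neighbour has not, so that
`χ_k(I) + χ_k(∂I) = χ_{k-1}(∂I) + χ_{k+1}(I)` (`extIndicator_promotion`).
Summing over the orbit, the sums of the `χ_k` have second difference zero along each segment, that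
is, they are affine in the position (`affine_of_second_difference_eq_zero`). Hence
`α_i χ_(i,j) - j χ_p - (α_i - j) χ_v` has orbit average zero, up to the constants contributed by
missing peaks and valleys.
-/

noncomputable section

namespace FencePromotion

/-! ### Orbit averages -/

section Orbit

variable {X : Type*} [Fintype X]

theorem mem_orbit {T : Equiv.Perm X} {x y : X} : y ∈ orbit T x ↔ T.SameCycle x y := by
  simp [orbit]

theorem card_orbit_ne_zero (T : Equiv.Perm X) (x : X) : ((orbit T x).card : ℝ) ≠ 0 := by
  have : x ∈ orbit T x := mem_orbit.2 (Equiv.Perm.SameCycle.refl T x)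
  exact_mod_cast Finset.card_ne_zero_of_mem this

theorem sum_orbit_apply (T : Equiv.Perm X) (f : X → ℝ) (x : X) :
    ∑ y ∈ orbit T x, f (T y) = ∑ y ∈ orbit T x, f y :=
  Finset.sum_equiv T (fun y => by rw [mem_orbit, mem_orbit, Equiv.Perm.sameCycle_apply_right])
    fun _ _ => rfl

theorem homomesic_of_sum_eq {T : Equiv.Perm X} {f : X → ℝ} (c : ℝ)
    (h : ∀ x, ∑ y ∈ orbit T x, f y = (orbit T x).card * c) : Homomesic T f :=
  ⟨c, fun x => by rw [h, mul_div_cancel_left₀ _ (card_orbit_ne_zero T x)]⟩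

theorem Homomesic.zero (T : Equiv.Perm X) : Homomesic T 0 := ⟨0, fun x => by simp⟩

theorem Homomesic.add {T : Equiv.Perm X} {f g : X → ℝ} (hf : Homomesic T f)
    (hg : Homomesic T g) : Homomesic T (f + g) := by
  obtain ⟨c, hc⟩ := hf
  obtain ⟨d, hd⟩ := hg
  exact ⟨c + d, fun x => by simp [Finset.sum_add_distrib, add_div, hc, hd]⟩

theorem Homomesic.smul {T : Equiv.Perm X} {f : X → ℝ} (a : ℝ) (hf : Homomesic T f) :
    Homomesic T (a • f) := by
  obtain ⟨c, hc⟩ := hf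
  exact ⟨a * c, fun x => by simp [← Finset.mul_sum, mul_div_assoc, hc]⟩

end Orbit

/-! ### Toggles -/

section Toggle

variable {P : Type*} [PartialOrder P]

theorem mem_toggle_of_ne {p q : P} (h : q ≠ p) (I : LowerSet P) : q ∈ toggle p I ↔ q ∈ I := by
  change q ∈ toggleFun p I ↔ q ∈ I
  unfold toggleFun
  split_ifs
  · rw [mem_addMin]; simp [h]
  · rw [mem_removeMax]; simp [h]
  · rfl

theorem mem_toggle_of_notMem {p : P} {I : LowerSet P} (hp : p ∉ I) :
    p ∈ toggle p I ↔ ∀ q < p, q ∈ I := by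
  change p ∈ toggleFun p I ↔ _
  unfold toggleFun
  split_ifs with h h'
  · rw [mem_addMin]
    refine iff_of_true (Or.inr rfl) fun q hq => ?_
    by_contra hqI
    exact hq.not_ge (h.2 hqI hq.le)
  · exact absurd h'.1 hp
  · refine iff_of_false hp fun hall => h ⟨hp, fun q hq hqp => ?_⟩
    by_contra hpq
    exact hq (hall q (lt_of_le_not_ge hqp hpq))

theorem mem_toggle_of_mem {p : P} {I : LowerSet P} (hp : p ∈ I) :
    p ∈ toggle p I ↔ ∃ q, p < q ∧ q ∈ I := by
  change p ∈ toggleFun p I ↔ _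
  unfold toggleFun
  split_ifs with h h'
  · exact absurd hp h.1
  · rw [mem_removeMax]
    refine iff_of_false (fun h => h.2 rfl) ?_
    rintro ⟨q, hpq, hq⟩
    exact hpq.not_ge (h'.2 hq hpq.le)
  · refine iff_of_true hp ?_
    by_contra hall
    refine h' ⟨hp, fun q hq hpq => ?_⟩
    by_contra hqp
    exact hall ⟨q, lt_of_le_not_ge hpq hqp, hq⟩

end Toggle

namespace Shape

variable {F : Shape}

/-! ### The order near an unshared element -/

/-- A position strictly inside a segment lies in no other segment. -/
theorem eq_of_inSegment {i j : Fin F.t} {x : F.Elem} (h1 : F.bd i.val < x.val)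
    (h2 : x.val < F.bd (i.val + 1)) (hj : InSegment j x) : j = i := by
  have hi : InSegment i x := ⟨h1.le, h2.le⟩
  rcases lt_trichotomy i.val j.val with h | h | h
  · exact absurd (meet h hi hj).2 h2.ne
  · exact (Fin.ext h).symm
  · obtain ⟨h3, h4⟩ := meet h hj hi
    rw [h3] at h1
    exact absurd h4 h1.ne'

theorem le_iff {x y : F.Elem} : x ≤ y ↔ Le x y := Iff.rfl

theorem lt_unshared_iff {i : Fin F.t} {p q : F.Elem} (h1 : F.bd i.val < p.val)
    (h2 : p.val < F.bd (i.val + 1)) :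
    q < p ↔ InSegment i q ∧ if Even i.val then q.val < p.val else p.val < q.val := by
  constructor
  · intro h
    have hne : q.val ≠ p.val := fun e => h.ne (Subtype.ext e)
    obtain ⟨j, hjq, hjp, hle⟩ := le_iff.1 h.le
    obtain rfl := eq_of_inSegment h1 h2 hjp
    refine ⟨hjq, ?_⟩
    split_ifs at hle ⊢ <;> omega
  · rintro ⟨hq, h⟩
    refine lt_of_le_of_ne (le_iff.2 ⟨i, hq, ⟨h1.le, h2.le⟩, ?_⟩) ?_
    · split_ifs at h ⊢ <;> omega
    · rintro rfl
      split_ifs at h <;> omega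

theorem unshared_lt_iff {i : Fin F.t} {p q : F.Elem} (h1 : F.bd i.val < p.val)
    (h2 : p.val < F.bd (i.val + 1)) :
    p < q ↔ InSegment i q ∧ if Even i.val then p.val < q.val else q.val < p.val := by
  constructor
  · intro h
    have hne : p.val ≠ q.val := fun e => h.ne (Subtype.ext e)
    obtain ⟨j, hjp, hjq, hle⟩ := le_iff.1 h.le
    obtain rfl := eq_of_inSegment h1 h2 hjp
    refine ⟨hjq, ?_⟩
    split_ifs at hle ⊢ <;> omega
  · rintro ⟨hq, h⟩
    refine lt_of_le_of_ne (le_iff.2 ⟨i, ⟨h1.le, h2.le⟩, hq, ?_⟩) ?_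
    · split_ifs at h ⊢ <;> omega
    · rintro rfl
      split_ifs at h <;> omega

theorem bd_zero : F.bd 0 = 0 := by simp [bd]

theorem bd_succ_le (i : Fin F.t) : F.bd (i.val + 1) ≤ F.bd F.t := bd_mono i.isLt

/-- Only the last segment reaches the place after the last element. -/
theorem val_add_one_eq_of_bd_le {i : Fin F.t} (h : F.bd F.t ≤ F.bd (i.val + 1)) :
    i.val + 1 = F.t := by
  by_contra hne
  have hlt : i.val + 1 < F.t := lt_of_le_of_ne i.isLt hne
  have h1 := bd_succ (F := F) ⟨i.val + 1, hlt⟩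
  have h2 := F.pos ⟨i.val + 1, hlt⟩
  have h3 := bd_succ_le (F := F) ⟨i.val + 1, hlt⟩
  simp only at h1 h3
  omega

theorem bd_pos_of_odd {i : Fin F.t} (h : ¬ Even i.val) : 0 < F.bd i.val := by
  have h0 : 0 < i.val := Nat.pos_of_ne_zero fun e => h (by simp [e])
  have h1 := bd_succ (F := F) ⟨0, lt_trans h0 i.isLt⟩
  have h2 := F.pos ⟨0, lt_trans h0 i.isLt⟩
  have h3 : F.bd (0 + 1) ≤ F.bd i.val := bd_mono h0
  simp only at h1
  omega

/-! ### Indicators extended beyond the ends of the fence -/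

variable (F) in
/-- The value attached to a position outside of the fence: `1` for the missing valley of the first
segment and of a decreasing last segment, `0` for the missing peak of an increasing last segment.
At positions inside of the fence it is `0`. -/
def boundaryValue (k : ℕ) : ℝ :=
  if 0 < k ∧ k < F.bd F.t then 0 else if k = 0 ∨ Even F.t then 1 else 0

variable (F) in
/-- Membership of position `k` in `I`, where a missing valley counts as present and a missing peak
as absent. -/
def ExtMem (k : ℕ) (I : LowerSet F.Elem) : Prop :=
  if h : 0 < k ∧ k < F.bd F.t then (⟨k, h⟩ : F.Elem) ∈ I else k = 0 ∨ Even F.t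

variable (F) in
/-- The indicator function of `ExtMem`. -/
def extIndicator (k : ℕ) (I : LowerSet F.Elem) : ℝ :=
  open Classical in if F.ExtMem k I then 1 else 0

theorem extMem_val (x : F.Elem) (I : LowerSet F.Elem) : F.ExtMem x.val I ↔ x ∈ I := by
  unfold ExtMem
  rw [dif_pos x.2]
  rfl

theorem extIndicator_eq (k : ℕ) (I : LowerSet F.Elem) :
    F.extIndicator k I = F.indicatorAt k I + F.boundaryValue k := by
  classical
  unfold extIndicator indicatorAt boundaryValue
  by_cases h : 0 < k ∧ k < F.bd F.t
  · rw [dif_pos h, if_pos h, add_zero]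
    exact if_congr (extMem_val ⟨k, h⟩ I) rfl rfl
  · rw [dif_neg h, if_neg h, Pi.zero_apply, zero_add]
    exact if_congr (by rw [ExtMem, dif_neg h]) rfl rfl

theorem extIndicator_of_extMem {k : ℕ} {I : LowerSet F.Elem} (h : F.ExtMem k I) :
    F.extIndicator k I = 1 := if_pos h

theorem extIndicator_of_not_extMem {k : ℕ} {I : LowerSet F.Elem} (h : ¬ F.ExtMem k I) :
    F.extIndicator k I = 0 := if_neg h

theorem extIndicator_congr {k l : ℕ} {I J : LowerSet F.Elem}
    (h : F.ExtMem k I ↔ F.ExtMem l J) : F.extIndicator k I = F.extIndicator l J := by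
  classical
  exact if_congr h rfl rfl

theorem extMem_congr {k : ℕ} {I J : LowerSet F.Elem}
    (h : ∀ x : F.Elem, x.val = k → (x ∈ I ↔ x ∈ J)) : F.ExtMem k I ↔ F.ExtMem k J := by
  unfold ExtMem
  split_ifs with hk
  · exact h _ rfl
  · rfl

/-- Everything below an unshared element lies in `I` if and only if its lower neighbour, the
position `d`, does. -/
theorem forall_lt_mem_iff {i : Fin F.t} {p : F.Elem} (h1 : F.bd i.val < p.val)
    (h2 : p.val < F.bd (i.val + 1)) {d : ℕ}
    (hd : if Even i.val then d + 1 = p.val else d = p.val + 1) (I : LowerSet F.Elem) :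
    (∀ q < p, q ∈ I) ↔ F.ExtMem d I := by
  have hle := bd_succ_le i
  have hp := p.2
  by_cases hin : 0 < d ∧ d < F.bd F.t
  · have hseg : InSegment i (⟨d, hin⟩ : F.Elem) := by
      constructor <;> simp only <;> split_ifs at hd <;> omega
    rw [show F.ExtMem d I ↔ (⟨d, hin⟩ : F.Elem) ∈ I from extMem_val ⟨d, hin⟩ I]
    constructor
    · intro h
      refine h _ ((lt_unshared_iff h1 h2).2 ⟨hseg, ?_⟩)
      split_ifs at hd ⊢ <;> simp only <;> omega
    · intro h q hq
      obtain ⟨hqs, hq⟩ := (lt_unshared_iff h1 h2).1 hq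
      refine I.lower (le_iff.2 ⟨i, hqs, hseg, ?_⟩) h
      split_ifs at hd hq ⊢ <;> simp only <;> omega
  · -- The lower neighbour is missing: nothing lies below, and `ExtMem` holds by convention.
    refine iff_of_true (fun q hq => ?_) ?_
    · obtain ⟨hqs, hq⟩ := (lt_unshared_iff h1 h2).1 hq
      have hq2 := q.2
      split_ifs at hd hq <;> omega
    · unfold ExtMem
      rw [dif_neg hin]
      split_ifs at hd with he
      · left; omega
      · right
        rw [← val_add_one_eq_of_bd_le (i := i) (by omega), Nat.even_add_one]
        exact he

/-- Something above an unshared element lies in `I` if and only if its upper neighbour, the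
position `u`, does. -/
theorem exists_gt_mem_iff {i : Fin F.t} {p : F.Elem} (h1 : F.bd i.val < p.val)
    (h2 : p.val < F.bd (i.val + 1)) {u : ℕ}
    (hu : if Even i.val then u = p.val + 1 else u + 1 = p.val) (I : LowerSet F.Elem) :
    (∃ q, p < q ∧ q ∈ I) ↔ F.ExtMem u I := by
  have hle := bd_succ_le i
  have hp := p.2
  by_cases hin : 0 < u ∧ u < F.bd F.t
  · have hseg : InSegment i (⟨u, hin⟩ : F.Elem) := by
      constructor <;> simp only <;> split_ifs at hu <;> omega
    rw [show F.ExtMem u I ↔ (⟨u, hin⟩ : F.Elem) ∈ I from extMem_val ⟨u, hin⟩ I]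
    constructor
    · rintro ⟨q, hq, hqI⟩
      obtain ⟨hqs, hq⟩ := (unshared_lt_iff h1 h2).1 hq
      refine I.lower (le_iff.2 ⟨i, hseg, hqs, ?_⟩) hqI
      split_ifs at hu hq ⊢ <;> simp only <;> omega
    · intro h
      refine ⟨_, (unshared_lt_iff h1 h2).2 ⟨hseg, ?_⟩, h⟩
      split_ifs at hu ⊢ <;> simp only <;> omega
  · -- The upper neighbour is missing: nothing lies above, and `ExtMem` fails by convention.
    refine iff_of_false ?_ ?_
    · rintro ⟨q, hq, -⟩
      obtain ⟨hqs, hq⟩ := (unshared_lt_iff h1 h2).1 hq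
      have hq2 := q.2
      split_ifs at hu hq <;> omega
    · unfold ExtMem
      rw [dif_neg hin]
      split_ifs at hu with he
      · rw [← val_add_one_eq_of_bd_le (i := i) (by omega), Nat.even_add_one]
        rintro (h | h)
        · omega
        · exact h he
      · have := bd_pos_of_odd he
        omega

/-- Toggling an unshared element is linear: the sum of the indicators before and after is the sum of
the indicators of the two neighbours. -/
theorem extIndicator_toggle {i : Fin F.t} {p : F.Elem} {m : ℕ} (hm : p.val = m + 1)
    (h1 : F.bd i.val ≤ m) (h2 : m + 2 ≤ F.bd (i.val + 1)) (J : LowerSet F.Elem) :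
    F.extIndicator (m + 1) J + F.extIndicator (m + 1) (toggle p J)
      = F.extIndicator m J + F.extIndicator (m + 2) J := by
  have h1' : F.bd i.val < p.val := by omega
  have h2' : p.val < F.bd (i.val + 1) := by omega
  obtain ⟨d, u, hd, hu, hsum⟩ : ∃ d u : ℕ, (if Even i.val then d + 1 = p.val else d = p.val + 1) ∧
      (if Even i.val then u = p.val + 1 else u + 1 = p.val) ∧
      F.extIndicator m J + F.extIndicator (m + 2) J
        = F.extIndicator d J + F.extIndicator u J := by
    by_cases he : Even i.val
    · exact ⟨m, m + 2, by simp only [he, if_true]; omega, by simp only [he, if_true]; omega, rfl⟩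
    · exact ⟨m + 2, m, by simp only [he, if_false]; omega, by simp only [he, if_false]; omega,
        add_comm _ _⟩
  have hlow := forall_lt_mem_iff h1' h2' hd J
  have hup := exists_gt_mem_iff h1' h2' hu J
  have hself := extMem_val p J
  have hnew := extMem_val p (toggle p J)
  rw [hm] at hself hnew
  rw [hsum]
  by_cases hp : p ∈ J
  · rw [extIndicator_of_extMem (hself.2 hp),
      extIndicator_of_extMem (hlow.1 fun q hq => J.lower hq.le hp),
      extIndicator_congr (hnew.trans ((mem_toggle_of_mem hp).trans hup))]
  · rw [extIndicator_of_not_extMem fun h => hp (hself.1 h),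
      extIndicator_of_not_extMem fun h => (hup.2 h).elim fun q hq => hp (J.lower hq.1.le hq.2),
      extIndicator_congr (hnew.trans ((mem_toggle_of_notMem hp).trans hlow)), add_comm]

/-! ### Promotion -/

variable (F) in
/-- The first `k` steps `τ_k ∘ ⋯ ∘ τ_1` of promotion. -/
def partialPromotion (k : ℕ) : Equiv.Perm (LowerSet F.Elem) :=
  ((List.ofFn fun k : Fin F.size => toggle (F.elem k)).take k).reverse.prod

theorem partialPromotion_zero : F.partialPromotion 0 = 1 := by simp [partialPromotion]

theorem partialPromotion_size : F.partialPromotion F.size = F.promotion := by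
  unfold partialPromotion promotion
  rw [List.take_of_length_le (by simp)]

theorem partialPromotion_succ {k : ℕ} (hk : k < F.size) (I : LowerSet F.Elem) :
    F.partialPromotion (k + 1) I = toggle (F.elem ⟨k, hk⟩) (F.partialPromotion k I) := by
  unfold partialPromotion
  rw [List.take_succ_eq_append_getElem (by simpa using hk)]
  rw [List.reverse_concat, List.prod_cons, List.getElem_ofFn, Equiv.Perm.mul_apply]

theorem mem_partialPromotion_succ {k : ℕ} (hk : k < F.size) {x : F.Elem} (hx : x.val ≠ k + 1)
    (I : LowerSet F.Elem) : x ∈ F.partialPromotion (k + 1) I ↔ x ∈ F.partialPromotion k I := by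
  rw [partialPromotion_succ hk]
  exact mem_toggle_of_ne (fun h => hx (by rw [h]; rfl)) _

theorem mem_partialPromotion_of_lt {k : ℕ} (hk : k ≤ F.size) {x : F.Elem} (hx : k < x.val)
    (I : LowerSet F.Elem) : x ∈ F.partialPromotion k I ↔ x ∈ I := by
  induction k with
  | zero => rw [partialPromotion_zero]; rfl
  | succ k ih =>
    rw [mem_partialPromotion_succ hk (by omega), ih (by omega) (by omega)]

theorem mem_partialPromotion_of_le {k : ℕ} (hk : k ≤ F.size) {x : F.Elem} (hx : x.val ≤ k)
    (I : LowerSet F.Elem) : x ∈ F.partialPromotion k I ↔ x ∈ F.promotion I := by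
  induction hk using Nat.decreasingInduction with
  | self => rw [partialPromotion_size]
  | of_succ k hk ih =>
    rw [← ih (by omega), mem_partialPromotion_succ hk (by omega)]

/-- When `x_{m+1}` is toggled, its left neighbour already has its new value and its right
neighbour still has its old one. -/
theorem extIndicator_promotion {i : Fin F.t} {m : ℕ} (h1 : F.bd i.val ≤ m)
    (h2 : m + 2 ≤ F.bd (i.val + 1)) (I : LowerSet F.Elem) :
    F.extIndicator (m + 1) I + F.extIndicator (m + 1) (F.promotion I)
      = F.extIndicator m (F.promotion I) + F.extIndicator (m + 2) I := by
  have hle := bd_succ_le i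
  have hm : m < F.size := by unfold size; omega
  have key := extIndicator_toggle (p := F.elem ⟨m, hm⟩) rfl h1 h2 (F.partialPromotion m I)
  rw [← partialPromotion_succ hm] at key
  have e1 : F.extIndicator (m + 1) (F.partialPromotion m I) = F.extIndicator (m + 1) I :=
    extIndicator_congr (extMem_congr fun x hx => mem_partialPromotion_of_lt hm.le (by omega) I)
  have e2 : F.extIndicator (m + 1) (F.partialPromotion (m + 1) I)
      = F.extIndicator (m + 1) (F.promotion I) :=
    extIndicator_congr (extMem_congr fun x hx => mem_partialPromotion_of_le hm (by omega) I)
  have e3 : F.extIndicator m (F.partialPromotion m I) = F.extIndicator m (F.promotion I) :=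
    extIndicator_congr (extMem_congr fun x hx => mem_partialPromotion_of_le hm.le (by omega) I)
  have e4 : F.extIndicator (m + 2) (F.partialPromotion m I) = F.extIndicator (m + 2) I :=
    extIndicator_congr (extMem_congr fun x hx => mem_partialPromotion_of_lt hm.le (by omega) I)
  rwa [e1, e2, e3, e4] at key

/-! ### Orbit sums are affine along segments -/

theorem affine_of_second_difference_eq_zero {s : ℕ → ℝ} {a n : ℕ}
    (h : ∀ m, a ≤ m → m + 2 ≤ a + n → 2 * s (m + 1) = s m + s (m + 2)) {j : ℕ} (hj : j ≤ n) :
    (n : ℝ) * s (a + j) = j * s (a + n) + (n - j : ℝ) * s a := by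
  have key : ∀ j, j + 1 ≤ n → s (a + j) = s a + j * (s (a + 1) - s a) ∧
      s (a + (j + 1)) = s a + (j + 1 : ℕ) * (s (a + 1) - s a) := by
    intro j
    induction j with
    | zero => intro _; simp
    | succ j ih =>
      intro hj
      obtain ⟨e1, e2⟩ := ih (by omega)
      refine ⟨e2, ?_⟩
      have e3 := h (a + j) (by omega) (by omega)
      rw [add_assoc, add_assoc, e1, e2] at e3
      have e4 : s (a + (j + 1 + 1)) = s (a + (j + 2)) := rfl
      push_cast at e3 ⊢
      linarith
  have all : ∀ j ≤ n, s (a + j) = s a + j * (s (a + 1) - s a) := by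
    rintro (_ | j) hj
    · simp
    · exact (key j hj).2
  rw [all j hj, all n le_rfl]
  ring

theorem sum_orbit_extIndicator (i : Fin F.t) {j : ℕ} (hj : j ≤ F.α i) (I : LowerSet F.Elem) :
    (F.α i : ℝ) * ∑ J ∈ orbit F.promotion I, F.extIndicator (F.bd i.val + j) J
      = j * ∑ J ∈ orbit F.promotion I, F.extIndicator (F.bd (i.val + 1)) J
        + (F.α i - j : ℝ) * ∑ J ∈ orbit F.promotion I, F.extIndicator (F.bd i.val) J := by
  rw [bd_succ]
  refine affine_of_second_difference_eq_zero
    (s := fun k => ∑ J ∈ orbit F.promotion I, F.extIndicator k J) (fun m h1 h2 => ?_) hj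
  have key : ∑ J ∈ orbit F.promotion I,
        (F.extIndicator (m + 1) J + F.extIndicator (m + 1) (F.promotion J))
      = ∑ J ∈ orbit F.promotion I,
        (F.extIndicator m (F.promotion J) + F.extIndicator (m + 2) J) :=
    Finset.sum_congr rfl fun J _ => extIndicator_promotion h1 (by rwa [bd_succ]) J
  rw [Finset.sum_add_distrib, Finset.sum_add_distrib, sum_orbit_apply F.promotion,
    sum_orbit_apply F.promotion] at key
  rw [two_mul, key]

theorem sum_orbit_unshared (i : Fin F.t) {j : ℕ} (hj : j ≤ F.α i) (I : LowerSet F.Elem) :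
    (F.α i : ℝ) * ∑ J ∈ orbit F.promotion I, F.extIndicator (unsharedPos i j) J
      = j * ∑ J ∈ orbit F.promotion I, F.extIndicator (peakPos i) J
        + (F.α i - j : ℝ) * ∑ J ∈ orbit F.promotion I, F.extIndicator (valleyPos i) J := by
  unfold unsharedPos peakPos valleyPos
  split_ifs
  · exact sum_orbit_extIndicator i hj I
  · -- On a decreasing segment, `j` steps from the valley are `α_i - j` steps from the left end.
    have e : F.bd (i.val + 1) - j = F.bd i.val + (F.α i - j) := by rw [bd_succ]; omega
    rw [e, sum_orbit_extIndicator i (Nat.sub_le _ _) I, Nat.cast_sub hj]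
    ring

theorem homomesic_basisStat (i : Fin F.t) {j : ℕ} (hj : j ≤ F.α i) :
    Homomesic F.promotion (basisStat i j) := by
  refine homomesic_of_sum_eq (j * F.boundaryValue (peakPos i)
    + (F.α i - j) * F.boundaryValue (valleyPos i)
    - F.α i * F.boundaryValue (unsharedPos i j)) fun I => ?_
  have key := sum_orbit_unshared i hj I
  simp only [extIndicator_eq, Finset.sum_add_distrib, Finset.sum_const, nsmul_eq_mul] at key
  simp only [basisStat, Finset.sum_sub_distrib, ← Finset.mul_sum]
  linear_combination key

end Shape

end FencePromotion

end

theorem mainTheorem12 (F : FencePromotion.Shape) (f : LowerSet F.Elem → ℝ)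
    (hf : f ∈ Submodule.span ℝ F.basisI) :
    FencePromotion.Homomesic F.promotion f := by
  induction hf using Submodule.span_induction with
  | mem f hf =>
    obtain ⟨i, j, -, hj, rfl⟩ := hf
    exact FencePromotion.Shape.homomesic_basisStat i (hj.trans (Nat.sub_le _ _))
  | zero => exact FencePromotion.Homomesic.zero _
  | add f g _ _ hf hg => exact hf.add hg
  | smul a f _ hf => exact hf.smul a
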